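/- **Setting.** Let $\mathbb K\in\{\mathbb R,\mathbb C\}$, let $N=Md$, and split each $v\in\mathbb K^N$ into $M$ consecutive blocks $v[1],\dots,v[M]$ of length $d$. Put $\operatorname{supp}(v)=\{i: v[i]\neq 0\}$ and $\mathcal X=\{v\in\mathbb K^N: |\operatorname{supp}(v)|\le k\}$. Let $D\in\mathbb K^{L\times N}$ be a known matrix with unit-norm columns and $L<N$; for $I\subseteq\{1,\dots,M\}$ let $D_I$ be the submatrix of the column blocks of $D$ indexed by $I$, and assume that $D_I$ has full column rank whenever $|I|\le k$. For $x\in\mathcal X$ one observes $y=Dx+w$, where $w\sim N(0,\sigma^2 I)$ with $\sigma>0$; for $\mathbb K=\mathbb C$ this is circularly symmetric complex Gaussian noise with covariance $E[ww^*]=\sigma^2 I$. An estimator is a measurable function $\hat x=\hat x(y)\in\mathbb K^N$; its bias is $b(x)=E_x[\hat x]-x$ and its mean-squared error is $\mathrm{MSE}(\hat x,x)=E_x\|\hat x-x\|_2^2\in[0,\infty]$. A vector $v\in\mathbb K^N$ is a feasible direction at $x$ if $x+\alpha v\in\mathcal X$ for all sufficiently small real $\alpha$. The estimator $\hat x$ is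 $\mathcal X$-unbiased at $x$ if $E_x[\hat x]=x$ and, for every feasible direction $v$ at $x$, $\frac{\partial}{\partial\alpha}\,b(x+\alpha v)\big|_{\alpha=0}=0$ (where $E_{x+\alpha v}[\hat x]$ is required to exist for all sufficiently small $\alpha$). **Theorem 2 (Cramér–Rao bound for block-sparse signals).** Let $x\in\mathcal X$ and $S=\operatorname{supp}(x)$. (a) If $|S|<k$, then no estimator with finite variance at $x$, i.e. with $E_x\|\hat x-E_x\hat x\|_2^2<\infty$, is $\mathcal X$-unbiased at $x$. (b) If $|S|=k$, then every estimator $\hat x$ that is $\mathcal X$-unbiased at $x$ satisfies $$\mathrm{MSE}(\hat x,x)\ \ge\ \sigma^2\,\mathrm{Tr}\big((D_S^*D_S)^{-1}\big).$$ -/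

import Mathlib

open MeasureTheory ProbabilityTheory Filter Topology

namespace BlockSparse

noncomputable section

variable {𝕜 : Type*} [RCLike 𝕜] {L M d : ℕ}

/-- Parameter vectors of length `N = M * d`, with the `ℓ²` norm. The entry `(i, j)` is the
`j`-th entry of the `i`-th block of length `d`. The field `𝕜` is `ℝ` or `ℂ`. -/
abbrev Param (𝕜 : Type*) (M d : ℕ) : Type _ := EuclideanSpace 𝕜 (Fin M × Fin d)

/-- The set of indices of the nonzero blocks of `v`. -/
def supp (v : Param 𝕜 M d) : Finset (Fin M) :=
  open Classical in Finset.univ.filter fun i => (fun j => v (i, j)) ≠ (0 : Fin d → 𝕜)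

/-- The constraint set: vectors with at most `k` nonzero blocks. -/
def constraintSet (𝕜 : Type*) [RCLike 𝕜] (M d k : ℕ) : Set (Param 𝕜 M d) :=
  {v | (supp v).card ≤ k}

/-- The submatrix `D_I` made of the column blocks of `D` indexed by `I`. -/
def subDict (D : Matrix (Fin L) (Fin M × Fin d) 𝕜) (I : Finset (Fin M)) :
    Matrix (Fin L) (I × Fin d) 𝕜 :=
  D.submatrix id fun p => (p.1.1, p.2)

/-- The standing assumptions on the dictionary: unit-norm atoms, fewer measurements than
parameters, and full column rank of every subdictionary made of at most `k` blocks. -/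
structure IsDictionary (D : Matrix (Fin L) (Fin M × Fin d) 𝕜) (k : ℕ) : Prop where
  normalized : ∀ p, ‖(WithLp.toLp 2 (D.col p) : EuclideanSpace 𝕜 (Fin L))‖ = 1
  underdetermined : L < M * d
  fullColumnRank : ∀ I : Finset (Fin M), I.card ≤ k → LinearIndependent 𝕜 (subDict D I).col

/-- The centred Gaussian law on `𝕜` with `E |w|² = σ²`. For `𝕜 = ℝ` (where `RCLike.I = 0`) it is
the law `N(0, σ²)`; for `𝕜 = ℂ` it is the circularly symmetric complex Gaussian law, whose real
and imaginary parts are independent with law `N(0, σ² / 2)`. -/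
def scalarNoise (𝕜 : Type*) [RCLike 𝕜] (σ : ℝ) : Measure 𝕜 :=
  ((gaussianReal 0 (σ ^ 2 / Module.finrank ℝ 𝕜).toNNReal).prod
    (gaussianReal 0 (σ ^ 2 / Module.finrank ℝ 𝕜).toNNReal)).map
      fun p => (p.1 : 𝕜) + (p.2 : 𝕜) * RCLike.I

/-- White Gaussian noise `w ~ N(0, σ² I)` in `𝕜^L`. -/
def noise (𝕜 : Type*) [RCLike 𝕜] (L : ℕ) (σ : ℝ) : Measure (Fin L → 𝕜) :=
  Measure.pi fun _ => scalarNoise 𝕜 σ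

/-- The law of the measurements `y = D x + w`. -/
def measLaw (D : Matrix (Fin L) (Fin M × Fin d) 𝕜) (σ : ℝ) (x : Param 𝕜 M d) :
    Measure (Fin L → 𝕜) :=
  (noise 𝕜 L σ).map fun w => D.mulVec x.ofLp + w

/-- The bias `b(x) = E_x[x̂] - x` of an estimator. -/
def bias (D : Matrix (Fin L) (Fin M × Fin d) 𝕜) (σ : ℝ)
    (xhat : (Fin L → 𝕜) → Param 𝕜 M d) (x : Param 𝕜 M d) : Param 𝕜 M d :=
  (∫ y, xhat y ∂(measLaw D σ x)) - x

/-- The mean-squared error `E_x ‖x̂ - x‖²`, possibly infinite. -/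
def mse (D : Matrix (Fin L) (Fin M × Fin d) 𝕜) (σ : ℝ)
    (xhat : (Fin L → 𝕜) → Param 𝕜 M d) (x : Param 𝕜 M d) : ENNReal :=
  ∫⁻ y, ‖xhat y - x‖ₑ ^ 2 ∂(measLaw D σ x)

/-- `v` is a feasible direction at `x`: `x + α v` satisfies the constraint for all sufficiently
small real `α`. -/
def IsFeasibleDirection (k : ℕ) (x v : Param 𝕜 M d) : Prop :=
  ∀ᶠ α : ℝ in 𝓝 0, x + α • v ∈ constraintSet 𝕜 M d k

/-- Local unbiasedness at `x` relative to the constraint set: the bias vanishes at `x`, and so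
does its derivative at `x` along each feasible direction; in particular the expectations that
occur in these conditions exist. -/
structure IsConstraintUnbiased (D : Matrix (Fin L) (Fin M × Fin d) 𝕜) (σ : ℝ) (k : ℕ)
    (xhat : (Fin L → 𝕜) → Param 𝕜 M d) (x : Param 𝕜 M d) : Prop where
  integrable : Integrable xhat (measLaw D σ x)
  bias_eq_zero : bias D σ xhat x = 0
  integrable_near : ∀ v, IsFeasibleDirection k x v →
    ∀ᶠ α : ℝ in 𝓝 0, Integrable xhat (measLaw D σ (x + α • v))
  hasDerivAt_bias : ∀ v, IsFeasibleDirection k x v →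
    HasDerivAt (fun α : ℝ => bias D σ xhat (x + α • v)) 0 0

/-- The estimator has finite variance at `x`: `E_x ‖x̂ - E_x x̂‖² < ∞`. -/
def HasFiniteVariance (D : Matrix (Fin L) (Fin M × Fin d) 𝕜) (σ : ℝ)
    (xhat : (Fin L → 𝕜) → Param 𝕜 M d) (x : Param 𝕜 M d) : Prop :=
  ∫⁻ y, ‖xhat y - ∫ z, xhat z ∂(measLaw D σ x)‖ₑ ^ 2 ∂(measLaw D σ x) < ⊤

end

end BlockSparse

/-! Shifting Gaussian noise multiplies its density by `exp (score - halfInfo)`, so the mean of a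
square-integrable statistic is differentiable in the shift, with derivative its correlation with the
score (`hasDerivAt_integral_comp_add`). Local unbiasedness therefore says that the error correlates
with the score in direction `D v` to give exactly `v`, for every feasible `v`
(`integral_score_smul_error`).

With a spare block, every single-block vector is feasible. The score is additive in its direction,
so the identity extends to sums of such vectors, hence to a nonzero `v` in the kernel of `D`, where
the score is zero: a contradiction.

With full support `S`, let `G` be the Gram matrix of `D_S`. For each coordinate `p` in `S`, the
error is compared with the least-squares error `a* w`, where `a = D_S G⁻¹ e_p`. Their correlation
and the second moment of `a* w` are both `σ² (G⁻¹)_pp`, which bounds the second moment of the error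
(`le_integral_norm_sq_of_score`); summing over `p` gives the trace. -/

namespace BlockSparse

noncomputable section

variable {𝕜 : Type*} [RCLike 𝕜] {L M d k : ℕ}

/-! ### Likelihood ratios of shifted Gaussian noise. -/

/-- A finite product of probability measures with densities has the product density. -/
theorem pi_withDensity {ι α : Type*} [Fintype ι] [MeasurableSpace α] (μ : Measure α)
    [IsProbabilityMeasure μ] (f : ι → α → ENNReal) (hf : ∀ i, Measurable (f i))
    [∀ i, SigmaFinite (μ.withDensity (f i))] :
    Measure.pi (fun i => μ.withDensity (f i)) =
      (Measure.pi fun _ : ι => μ).withDensity fun w => ∏ i, f i (w i) := by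
  refine Measure.pi_eq fun t ht => ?_
  -- On a box the density is a product of functions of independent coordinates, so its integral
  -- factors.
  have hind : iIndepFun (fun i (w : ι → α) => (t i).indicator (f i) (w i))
      (Measure.pi fun _ : ι => μ) :=
    iIndepFun_pi fun i => ((hf i).indicator (ht i)).aemeasurable
  have hprod : ∀ w : ι → α, (Set.univ.pi t).indicator (fun w => ∏ i, f i (w i)) w =
      ∏ i, (t i).indicator (f i) (w i) := by
    intro w
    by_cases hw : w ∈ Set.univ.pi t
    · rw [Set.indicator_of_mem hw]
      exact Finset.prod_congr rfl fun i _ => (Set.indicator_of_mem (hw i trivial) _).symm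
    · rw [Set.indicator_of_notMem hw]
      obtain ⟨i, hi⟩ : ∃ i, w i ∉ t i := by simpa [Set.mem_pi] using hw
      exact (Finset.prod_eq_zero (Finset.mem_univ i) (Set.indicator_of_notMem hi _)).symm
  rw [withDensity_apply _ (MeasurableSet.univ_pi ht),
    ← lintegral_indicator (MeasurableSet.univ_pi ht), lintegral_congr hprod,
    lintegral_prod_eq_prod_lintegral_of_indepFun _ _ hind
      fun i => ((hf i).indicator (ht i)).comp (measurable_pi_apply i)]
  refine Finset.prod_congr rfl fun i _ => ?_
  rw [withDensity_apply _ (ht i), ← lintegral_indicator (ht i)]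
  exact (measurePreserving_eval (fun _ : ι => μ) i).lintegral_comp ((hf i).indicator (ht i))

/-- The shift of a real Gaussian law has the likelihood ratio as its density. -/
theorem gaussianReal_eq_withDensity (a : ℝ) {v : NNReal} (hv : v ≠ 0) :
    gaussianReal a v = (gaussianReal 0 v).withDensity
      fun p => ENNReal.ofReal (Real.exp ((a * p - a ^ 2 / 2) / v)) := by
  rw [gaussianReal_of_var_ne_zero _ hv, gaussianReal_of_var_ne_zero _ hv,
    ← withDensity_mul _ (measurable_gaussianPDF _ _) (by fun_prop)]
  congr 1
  funext p
  have hv' : (v : ℝ) ≠ 0 := by exact_mod_cast hv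
  rw [Pi.mul_apply, gaussianPDF, gaussianPDF,
    ← ENNReal.ofReal_mul (gaussianPDFReal_nonneg _ _ _)]
  congr 1
  simp only [gaussianPDFReal, mul_assoc, ← Real.exp_add]
  congr 2
  field_simp
  ring

/-- The variance of each real component of the noise. -/
def noiseVar (𝕜 : Type*) [RCLike 𝕜] (σ : ℝ) : ℝ := σ ^ 2 / Module.finrank ℝ 𝕜

theorem noiseVar_pos {σ : ℝ} (hσ : 0 < σ) : 0 < noiseVar 𝕜 σ := by
  have : 0 < Module.finrank ℝ 𝕜 := Module.finrank_pos
  unfold noiseVar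
  positivity

instance isProbabilityMeasure_scalarNoise (σ : ℝ) : IsProbabilityMeasure (scalarNoise 𝕜 σ) :=
  Measure.isProbabilityMeasure_map (by fun_prop)

instance isProbabilityMeasure_noise (σ : ℝ) : IsProbabilityMeasure (noise 𝕜 L σ) := by
  unfold noise; infer_instance

/-- The shift by `a` lifts to the shift of the underlying real pair by `(re a, im a)`, whose two
likelihood ratios multiply. -/
theorem scalarNoise_map_const_add {σ : ℝ} (hσ : 0 < σ) (a : 𝕜) :
    (scalarNoise 𝕜 σ).map (fun z => a + z) = (scalarNoise 𝕜 σ).withDensity fun z =>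
      ENNReal.ofReal (Real.exp ((RCLike.re (star a * z) - ‖a‖ ^ 2 / 2) / noiseVar 𝕜 σ)) := by
  have hs := noiseVar_pos (𝕜 := 𝕜) hσ
  have hv : (noiseVar 𝕜 σ).toNNReal ≠ 0 := by simpa using hs
  have hcoe : ((noiseVar 𝕜 σ).toNNReal : ℝ) = noiseVar 𝕜 σ := Real.coe_toNNReal _ hs.le
  set g := gaussianReal 0 (noiseVar 𝕜 σ).toNNReal with hg
  have hφ : Measurable fun p : ℝ × ℝ => (p.1 : 𝕜) + (p.2 : 𝕜) * RCLike.I := by fun_prop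
  have hnoise : scalarNoise 𝕜 σ = (g.prod g).map fun p => (p.1 : 𝕜) + (p.2 : 𝕜) * RCLike.I := rfl
  have hshift : ∀ b : ℝ, g.map (fun q => b + q) = g.withDensity fun p =>
      ENNReal.ofReal (Real.exp ((b * p - b ^ 2 / 2) / noiseVar 𝕜 σ)) := by
    intro b
    rw [hg, gaussianReal_map_const_add, zero_add, gaussianReal_eq_withDensity b hv, hcoe]
  have hsf : ∀ b : ℝ, IsProbabilityMeasure (g.withDensity fun p =>
      ENNReal.ofReal (Real.exp ((b * p - b ^ 2 / 2) / noiseVar 𝕜 σ))) := by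
    intro b
    rw [← hshift]
    exact Measure.isProbabilityMeasure_map (by fun_prop)
  have hcomp : (fun z => a + z) ∘ (fun p : ℝ × ℝ => (p.1 : 𝕜) + (p.2 : 𝕜) * RCLike.I) =
      (fun p : ℝ × ℝ => (p.1 : 𝕜) + (p.2 : 𝕜) * RCLike.I) ∘
        Prod.map (fun q => RCLike.re a + q) (fun q => RCLike.im a + q) := by
    funext p
    simp only [Function.comp_apply, Prod.map_fst, Prod.map_snd, RCLike.ofReal_add]
    conv_lhs => rw [← RCLike.re_add_im a]
    ring
  rw [hnoise, Measure.map_map (by fun_prop) hφ, hcomp, ← Measure.map_map hφ (by fun_prop),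
    ← Measure.map_prod_map _ _ (by fun_prop) (by fun_prop), hshift, hshift,
    prod_withDensity (by fun_prop) (by fun_prop)]
  refine Measure.ext fun t ht => ?_
  rw [Measure.map_apply hφ ht, withDensity_apply _ (hφ ht), withDensity_apply _ ht,
    setLIntegral_map ht (by fun_prop) hφ]
  refine setLIntegral_congr_fun (hφ ht) fun p _ => ?_
  rw [← ENNReal.ofReal_mul (Real.exp_nonneg _), ← Real.exp_add]
  congr 2
  rw [← RCLike.normSq_eq_def', RCLike.normSq_apply]
  -- `im a * im I = im a` treats both fields at once: either `im a = 0` or `im I = 1`.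
  have h1 := RCLike.I_im a
  simp only [RCLike.star_def, RCLike.mul_re, RCLike.conj_re, RCLike.conj_im, map_add,
    RCLike.ofReal_re, RCLike.ofReal_im, RCLike.I_re, RCLike.mul_im]
  rw [← add_div]
  congr 1
  linear_combination (-p.2) * h1

/-! ### The score and its exponential moments. -/

/-- The derivative of the log-likelihood at the true mean, in the direction `u`. -/
def score (σ : ℝ) (u w : Fin L → 𝕜) : ℝ := RCLike.re (star u ⬝ᵥ w) / noiseVar 𝕜 σ

/-- Half the Fisher information in the direction `u`. -/
def halfInfo (σ : ℝ) (u : Fin L → 𝕜) : ℝ := (∑ i, ‖u i‖ ^ 2 / 2) / noiseVar 𝕜 σ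

theorem halfInfo_nonneg {σ : ℝ} (hσ : 0 < σ) (u : Fin L → 𝕜) : 0 ≤ halfInfo σ u :=
  div_nonneg (Finset.sum_nonneg fun _ _ => by positivity) (noiseVar_pos hσ).le

@[fun_prop]
theorem measurable_score (σ : ℝ) (u : Fin L → 𝕜) : Measurable (score σ u) := by
  unfold score dotProduct
  fun_prop

/-- The Cameron–Martin formula for white noise. -/
theorem noise_map_const_add {σ : ℝ} (hσ : 0 < σ) (u : Fin L → 𝕜) :
    (noise 𝕜 L σ).map (fun w => u + w) = (noise 𝕜 L σ).withDensity fun w =>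
      ENNReal.ofReal (Real.exp (score σ u w - halfInfo σ u)) := by
  have h1 : (noise 𝕜 L σ).map (fun w => u + w) =
      Measure.pi fun i => (scalarNoise 𝕜 σ).map fun z => u i + z :=
    Measure.pi_map_pi (μ := fun _ : Fin L => scalarNoise 𝕜 σ) (f := fun i z => u i + z)
      fun i => by fun_prop
  have hsf : ∀ i, IsProbabilityMeasure ((scalarNoise 𝕜 σ).withDensity fun z =>
      ENNReal.ofReal (Real.exp ((RCLike.re (star (u i) * z) - ‖u i‖ ^ 2 / 2) /
        noiseVar 𝕜 σ))) := by
    intro i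
    rw [← scalarNoise_map_const_add hσ]
    exact Measure.isProbabilityMeasure_map (by fun_prop)
  rw [h1]
  simp_rw [scalarNoise_map_const_add hσ]
  rw [pi_withDensity _ _ fun i => by fun_prop]
  unfold noise
  congr 1
  funext w
  rw [← ENNReal.ofReal_prod_of_nonneg fun _ _ => Real.exp_nonneg _, ← Real.exp_sum]
  congr 2
  simp only [score, halfInfo, dotProduct, map_sum, Pi.star_apply]
  rw [← sub_div, ← Finset.sum_sub_distrib, Finset.sum_div]

theorem score_smul (σ t : ℝ) (u w : Fin L → 𝕜) : score σ (t • u) w = t * score σ u w := by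
  simp [score, RCLike.smul_re, mul_div_assoc]

theorem halfInfo_smul (σ t : ℝ) (u : Fin L → 𝕜) :
    halfInfo σ (t • u) = t ^ 2 * halfInfo σ u := by
  simp only [halfInfo, Pi.smul_apply, norm_smul, mul_pow, Real.norm_eq_abs, sq_abs, mul_div_assoc,
    ← Finset.mul_sum]

/-- Up to a constant factor this is the density of the noise shifted by `t • u`, a probability
measure. -/
theorem integrable_exp_score {σ : ℝ} (hσ : 0 < σ) (u : Fin L → 𝕜) (t : ℝ) :
    Integrable (fun w => Real.exp (t * score σ u w)) (noise 𝕜 L σ) := by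
  have hp : IsProbabilityMeasure ((noise 𝕜 L σ).map fun w => t • u + w) :=
    Measure.isProbabilityMeasure_map (by fun_prop)
  have h1 : Integrable (fun _ => (1 : ℝ)) ((noise 𝕜 L σ).map fun w => t • u + w) :=
    integrable_const _
  rw [noise_map_const_add hσ, integrable_withDensity_iff_integrable_smul' (by fun_prop)
    (by simp)] at h1
  refine (h1.mul_const (Real.exp (halfInfo σ (t • u)))).congr (ae_of_all _ fun w => ?_)
  simp only [smul_eq_mul, mul_one, ENNReal.toReal_ofReal (Real.exp_nonneg _), ← Real.exp_add,
    sub_add_cancel, score_smul]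

theorem integrable_exp_abs_score {σ : ℝ} (hσ : 0 < σ) (u : Fin L → 𝕜) (t : ℝ) :
    Integrable (fun w => Real.exp (t * |score σ u w|)) (noise 𝕜 L σ) :=
  integrable_exp_mul_abs (integrable_exp_score hσ u t) (integrable_exp_score hσ u (-t))

theorem memLp_exp_abs_score {σ : ℝ} (hσ : 0 < σ) (u : Fin L → 𝕜) (t : ℝ) :
    MemLp (fun w => Real.exp (t * |score σ u w|)) 2 (noise 𝕜 L σ) := by
  rw [memLp_two_iff_integrable_sq (by fun_prop)]
  refine (integrable_exp_abs_score hσ u (2 * t)).congr (ae_of_all _ fun w => ?_)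
  simp only [← Real.exp_nat_mul]
  congr 1
  push_cast
  ring

theorem memLp_score {σ : ℝ} (hσ : 0 < σ) (u : Fin L → 𝕜) :
    MemLp (score σ u) 2 (noise 𝕜 L σ) := by
  refine (memLp_exp_abs_score hσ u 1).mono (by fun_prop) (ae_of_all _ fun w => ?_)
  rw [Real.norm_eq_abs, Real.norm_eq_abs, Real.abs_exp, one_mul]
  linarith [Real.add_one_le_exp |score σ u w|]

/-! ### Differentiating means in the location parameter. -/

section Derivative

variable {E : Type*} [NormedAddCommGroup E] [NormedSpace ℝ E]

theorem integral_comp_const_add {σ : ℝ} (hσ : 0 < σ) (u : Fin L → 𝕜)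
    (T : (Fin L → 𝕜) → E) :
    ∫ w, T (u + w) ∂noise 𝕜 L σ =
      ∫ w, Real.exp (score σ u w - halfInfo σ u) • T w ∂noise 𝕜 L σ := by
  have h1 : ∫ w, T (u + w) ∂noise 𝕜 L σ = ∫ w, T w ∂(noise 𝕜 L σ).map fun w => u + w :=
    (integral_map_equiv (MeasurableEquiv.addLeft u) T).symm
  rw [h1, noise_map_const_add hσ,
    integral_withDensity_eq_integral_toReal_smul (by fun_prop) (by simp)]
  simp_rw [ENNReal.toReal_ofReal (Real.exp_nonneg _)]

theorem integrable_score_smul {σ : ℝ} (hσ : 0 < σ) (u : Fin L → 𝕜) {T : (Fin L → 𝕜) → E}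
    (hT : MemLp T 2 (noise 𝕜 L σ)) :
    Integrable (fun w => score σ u w • T w) (noise 𝕜 L σ) := by
  have h := hT.smul (memLp_score hσ u) (r := 1)
  exact memLp_one_iff_integrable.1 h

/-- The mean of a square-integrable statistic is differentiable in the location parameter, and
its derivative is its correlation with the score. -/
theorem hasDerivAt_integral_comp_add {σ : ℝ} (hσ : 0 < σ) (u : Fin L → 𝕜)
    {T : (Fin L → 𝕜) → E} (hT : MemLp T 2 (noise 𝕜 L σ)) :
    HasDerivAt (fun t : ℝ => ∫ w, T (t • u + w) ∂noise 𝕜 L σ)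
      (∫ w, score σ u w • T w ∂noise 𝕜 L σ) 0 := by
  simp_rw [integral_comp_const_add hσ, score_smul, halfInfo_smul]
  set c := halfInfo σ u with hc
  have hc0 : 0 ≤ c := halfInfo_nonneg hσ u
  have hTm := hT.aestronglyMeasurable
  have key := hasDerivAt_integral_of_dominated_loc_of_deriv_le (𝕜 := ℝ) (μ := noise 𝕜 L σ)
    (x₀ := (0 : ℝ)) (s := Metric.ball 0 1) (Metric.ball_mem_nhds _ one_pos)
    (F := fun t w => Real.exp (t * score σ u w - t ^ 2 * c) • T w)
    (F' := fun t w => (Real.exp (t * score σ u w - t ^ 2 * c) *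
      (score σ u w - 2 * t * c)) • T w)
    -- For `|t| ≤ 1`, one factor `exp |score|` bounds the likelihood ratio and another, with `1 + 2
    -- * c`, bounds the derivative of its exponent. Hölder makes the product with `‖T w‖`
    -- integrable.
    (bound := fun w => (1 + 2 * c) * (Real.exp (2 * |score σ u w|) * ‖T w‖))
    (Eventually.of_forall fun t => by
      have : Measurable fun w : Fin L → 𝕜 => Real.exp (t * score σ u w - t ^ 2 * c) := by fun_prop
      exact this.aestronglyMeasurable.smul hTm)
    (by simpa using hT.integrable one_le_two)
    (by
      have : Measurable fun w : Fin L → 𝕜 => Real.exp (0 * score σ u w - 0 ^ 2 * c) *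
        (score σ u w - 2 * 0 * c) := by fun_prop
      exact this.aestronglyMeasurable.smul hTm)
    (ae_of_all _ fun w t ht => by
      have ht1 : |t| ≤ 1 := by simpa using (Metric.mem_ball.1 ht).le
      set l := score σ u w
      have hl : 0 ≤ |l| := abs_nonneg l
      have h1 : Real.exp (t * l - t ^ 2 * c) ≤ Real.exp |l| := by
        apply Real.exp_le_exp.2
        have : t * l ≤ |l| := by
          calc t * l ≤ |t * l| := le_abs_self _
            _ = |t| * |l| := abs_mul _ _
            _ ≤ 1 * |l| := by gcongr
            _ = |l| := one_mul _
        nlinarith [mul_nonneg (sq_nonneg t) hc0]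
      have h2 : |l - 2 * t * c| ≤ (1 + 2 * c) * Real.exp |l| := by
        have h3 : |2 * t * c| ≤ 2 * c := by
          rw [abs_mul, abs_mul, abs_two, abs_of_nonneg hc0]
          nlinarith
        have h4 := Real.add_one_le_exp |l|
        calc |l - 2 * t * c| ≤ |l| + |2 * t * c| := abs_sub _ _
          _ ≤ |l| + 2 * c := by linarith
          _ ≤ (1 + 2 * c) * Real.exp |l| := by nlinarith [Real.exp_pos |l|]
      have h5 : Real.exp (2 * |l|) = Real.exp |l| * Real.exp |l| := by
        rw [← Real.exp_add]; ring_nf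
      rw [norm_smul, norm_mul, Real.norm_eq_abs, Real.norm_eq_abs, Real.abs_exp, h5]
      calc Real.exp (t * l - t ^ 2 * c) * |l - 2 * t * c| * ‖T w‖
          ≤ Real.exp |l| * ((1 + 2 * c) * Real.exp |l|) * ‖T w‖ := by gcongr
        _ = (1 + 2 * c) * (Real.exp |l| * Real.exp |l| * ‖T w‖) := by ring)
    (((memLp_exp_abs_score hσ u 2).integrable_mul hT.norm).const_mul _)
    (ae_of_all _ fun w t _ => by
      refine HasDerivAt.smul_const ?_ _
      have h1 : HasDerivAt (fun t : ℝ => t * score σ u w - t ^ 2 * c)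
          (score σ u w - 2 * t * c) t := by
        have := ((hasDerivAt_id t).mul_const (score σ u w)).sub
          (((hasDerivAt_id t).pow 2).mul_const c)
        exact this.congr_deriv (by simp)
      exact h1.exp)
  simpa using key.2

end Derivative

/-! ### The scalar Cramér–Rao bound over both fields. -/

/-- The directions `a` and `I • a` contribute `re c` and `im I * re c`; this turns their sum times
the component variance into `σ ^ 2 * re c`. -/
theorem finrank_eq_one_add_im_I : (Module.finrank ℝ 𝕜 : ℝ) = 1 + RCLike.im (RCLike.I : 𝕜) := by
  obtain h | h := RCLike.I_eq_zero_or_im_I_eq_one (K := 𝕜)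
  · rw [(RCLike.realLinearIsometryEquiv h).toLinearEquiv.finrank_eq, h]
    simp
  · rw [(RCLike.complexLinearIsometryEquiv h).toLinearEquiv.finrank_eq, h,
      Complex.finrank_real_complex]
    norm_num

theorem noiseVar_mul_one_add_im_I (σ : ℝ) :
    noiseVar 𝕜 σ * (1 + RCLike.im (RCLike.I : 𝕜)) = σ ^ 2 := by
  have : (Module.finrank ℝ 𝕜 : ℝ) ≠ 0 := by exact_mod_cast (Module.finrank_pos (R := ℝ)).ne'
  rw [← finrank_eq_one_add_im_I, noiseVar, div_mul_cancel₀ _ this]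

theorem noiseVar_mul_score {σ : ℝ} (hσ : 0 < σ) (a w : Fin L → 𝕜) :
    noiseVar 𝕜 σ * score σ a w = RCLike.re (star a ⬝ᵥ w) :=
  mul_div_cancel₀ _ (noiseVar_pos hσ).ne'

theorem noiseVar_mul_score_I_smul {σ : ℝ} (hσ : 0 < σ) (a w : Fin L → 𝕜) :
    noiseVar 𝕜 σ * score σ ((RCLike.I : 𝕜) • a) w = RCLike.im (star a ⬝ᵥ w) := by
  rw [noiseVar_mul_score hσ, star_smul, smul_dotProduct]
  simp [RCLike.I_im']

/-- The real and imaginary parts are multiples of the scores in the directions `a` and `I • a`. -/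
theorem memLp_dotProduct {σ : ℝ} (hσ : 0 < σ) (a : Fin L → 𝕜) :
    MemLp (fun w => star a ⬝ᵥ w) 2 (noise 𝕜 L σ) := by
  have h1 : MemLp (fun w => ((noiseVar 𝕜 σ * score σ a w : ℝ) : 𝕜)) 2 (noise 𝕜 L σ) :=
    ((memLp_score hσ a).const_mul _).ofReal
  have h2 : MemLp (fun w => ((noiseVar 𝕜 σ * score σ ((RCLike.I : 𝕜) • a) w : ℝ) : 𝕜)) 2
      (noise 𝕜 L σ) :=
    ((memLp_score hσ _).const_mul _).ofReal
  refine (h1.add (h2.mul_const (RCLike.I : 𝕜))).ae_eq (ae_of_all _ fun w => ?_)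
  simp only [Pi.add_apply]
  rw [noiseVar_mul_score hσ, noiseVar_mul_score_I_smul hσ, RCLike.re_add_im]

/-- The score is dual to the noise. -/
theorem integral_score_smul_dotProduct {σ : ℝ} (hσ : 0 < σ) (u a : Fin L → 𝕜) :
    ∫ w, score σ u w • (star a ⬝ᵥ w) ∂noise 𝕜 L σ = star a ⬝ᵥ u := by
  -- The mean of a linear statistic is affine in the shift; uniqueness of derivatives replaces a
  -- covariance computation.
  refine (hasDerivAt_integral_comp_add hσ u (memLp_dotProduct hσ a)).unique ?_
  have hint := (memLp_dotProduct hσ a).integrable one_le_two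
  have h1 : (fun t : ℝ => ∫ w, star a ⬝ᵥ (t • u + w) ∂noise 𝕜 L σ) =
      fun t : ℝ => t • (star a ⬝ᵥ u) + ∫ w, star a ⬝ᵥ w ∂noise 𝕜 L σ := by
    funext t
    simp_rw [dotProduct_add, dotProduct_smul]
    rw [integral_add (integrable_const _) hint]
    simp
  rw [h1]
  simpa using ((hasDerivAt_id (0 : ℝ)).smul_const (star a ⬝ᵥ u)).add_const
    (∫ w, star a ⬝ᵥ w ∂noise 𝕜 L σ)

theorem re_star_mul_eq {σ : ℝ} (hσ : 0 < σ) (a w : Fin L → 𝕜) (z : 𝕜) :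
    RCLike.re (star (star a ⬝ᵥ w) * z) = noiseVar 𝕜 σ * (RCLike.re (score σ a w • z) +
      RCLike.im (score σ ((RCLike.I : 𝕜) • a) w • z)) := by
  rw [RCLike.smul_re, RCLike.smul_im, mul_add, ← mul_assoc, ← mul_assoc, noiseVar_mul_score hσ,
    noiseVar_mul_score_I_smul hσ]
  simp [RCLike.mul_re]

theorem integrable_re_star_mul {σ : ℝ} (hσ : 0 < σ) (a : Fin L → 𝕜) {Z : (Fin L → 𝕜) → 𝕜}
    (hZ : MemLp Z 2 (noise 𝕜 L σ)) :
    Integrable (fun w => RCLike.re (star (star a ⬝ᵥ w) * Z w)) (noise 𝕜 L σ) := by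
  simp_rw [re_star_mul_eq hσ]
  exact ((integrable_score_smul hσ a hZ).re.add (integrable_score_smul hσ _ hZ).im).const_mul _

/-- The correlation of a square-integrable statistic with a linear functional of the noise, in
terms of its correlations with the scores. -/
theorem integral_re_star_mul {σ : ℝ} (hσ : 0 < σ) (a : Fin L → 𝕜) {Z : (Fin L → 𝕜) → 𝕜}
    (hZ : MemLp Z 2 (noise 𝕜 L σ)) :
    ∫ w, RCLike.re (star (star a ⬝ᵥ w) * Z w) ∂noise 𝕜 L σ =
      noiseVar 𝕜 σ * (RCLike.re (∫ w, score σ a w • Z w ∂noise 𝕜 L σ) +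
        RCLike.im (∫ w, score σ ((RCLike.I : 𝕜) • a) w • Z w ∂noise 𝕜 L σ)) := by
  have h1 := integrable_score_smul hσ a hZ
  have h2 := integrable_score_smul hσ ((RCLike.I : 𝕜) • a) hZ
  simp_rw [re_star_mul_eq hσ]
  rw [integral_const_mul, integral_add h1.re h2.im, integral_re h1, integral_im h2]

/-- If the scores in the directions `a` and `I • a` have correlations `c` and `I * c` with `Z`,
then the correlation of `Z` with the noise in the direction `a` is `σ ^ 2 * re c`. -/
theorem integral_re_star_mul_of_score {σ : ℝ} (hσ : 0 < σ) (a : Fin L → 𝕜)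
    {Z : (Fin L → 𝕜) → 𝕜} (hZ : MemLp Z 2 (noise 𝕜 L σ)) (c : 𝕜)
    (h1 : ∫ w, score σ a w • Z w ∂noise 𝕜 L σ = c)
    (h2 : ∫ w, score σ ((RCLike.I : 𝕜) • a) w • Z w ∂noise 𝕜 L σ = RCLike.I * c) :
    ∫ w, RCLike.re (star (star a ⬝ᵥ w) * Z w) ∂noise 𝕜 L σ = σ ^ 2 * RCLike.re c := by
  rw [integral_re_star_mul hσ a hZ, h1, h2, ← noiseVar_mul_one_add_im_I (𝕜 := 𝕜) σ, RCLike.mul_im,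
    RCLike.I_re]
  ring

/-- A scalar Cramér–Rao bound. -/
theorem le_integral_norm_sq_of_score {σ : ℝ} (hσ : 0 < σ) (a : Fin L → 𝕜)
    {Z : (Fin L → 𝕜) → 𝕜} (hZ : MemLp Z 2 (noise 𝕜 L σ))
    (h1 : ∫ w, score σ a w • Z w ∂noise 𝕜 L σ = star a ⬝ᵥ a)
    (h2 : ∫ w, score σ ((RCLike.I : 𝕜) • a) w • Z w ∂noise 𝕜 L σ = RCLike.I * (star a ⬝ᵥ a)) :
    σ ^ 2 * RCLike.re (star a ⬝ᵥ a) ≤ ∫ w, ‖Z w‖ ^ 2 ∂noise 𝕜 L σ := by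
  have hR := memLp_dotProduct (𝕜 := 𝕜) hσ a
  have e1 := integral_re_star_mul_of_score hσ a hZ _ h1 h2
  -- The functional `star a ⬝ᵥ w` satisfies the same score identities as `Z`, so both correlations
  -- have the same value.
  have e2 := integral_re_star_mul_of_score hσ a hR _ (integral_score_smul_dotProduct hσ a a)
    (by rw [integral_score_smul_dotProduct hσ, dotProduct_smul, smul_eq_mul])
  have i1 := integrable_re_star_mul hσ a hZ
  have i2 := integrable_re_star_mul hσ a hR
  -- Integrated form of `|Z - R|² ≥ 0` with `R = star a ⬝ᵥ w`, already optimally scaled, in place of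
  -- Cauchy–Schwarz.
  have key : ∫ w, (2 * RCLike.re (star (star a ⬝ᵥ w) * Z w) -
      RCLike.re (star (star a ⬝ᵥ w) * (star a ⬝ᵥ w))) ∂noise 𝕜 L σ ≤
        ∫ w, ‖Z w‖ ^ 2 ∂noise 𝕜 L σ := by
    refine integral_mono ((i1.const_mul 2).sub i2) hZ.integrable_norm_pow' fun w => ?_
    rw [← RCLike.normSq_eq_def', RCLike.normSq_apply]
    simp only [RCLike.star_def, RCLike.mul_re, RCLike.conj_re, RCLike.conj_im]
    nlinarith [sq_nonneg (RCLike.re (Z w) - RCLike.re (star a ⬝ᵥ w)),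
      sq_nonneg (RCLike.im (Z w) - RCLike.im (star a ⬝ᵥ w))]
  rw [integral_sub (i1.const_mul 2) i2, integral_const_mul, e1, e2] at key
  linarith

/-! ### Feasible directions and local unbiasedness. -/

theorem mem_supp {v : Param 𝕜 M d} {i : Fin M} : i ∈ supp v ↔ ∃ j, v (i, j) ≠ 0 := by
  simp [supp, funext_iff]

theorem isFeasibleDirection_of_supp_subset {x v : Param 𝕜 M d} {I : Finset (Fin M)}
    (hx : supp x ⊆ I) (hv : supp v ⊆ I) (hI : I.card ≤ k) : IsFeasibleDirection k x v := by
  refine Eventually.of_forall fun α => (Finset.card_le_card fun i hi => ?_).trans hI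
  obtain ⟨j, hj⟩ := mem_supp.1 hi
  by_contra hiI
  refine hj ?_
  have h1 : x (i, j) = 0 := by_contra fun h => hiI (hx (mem_supp.2 ⟨j, h⟩))
  have h2 : v (i, j) = 0 := by_contra fun h => hiI (hv (mem_supp.2 ⟨j, h⟩))
  simp [h1, h2]

section Estimator

variable {D : Matrix (Fin L) (Fin M × Fin d) 𝕜} {σ : ℝ}
  {xhat : (Fin L → 𝕜) → Param 𝕜 M d} {x : Param 𝕜 M d}

theorem mulVec_add_smul (D : Matrix (Fin L) (Fin M × Fin d) 𝕜) (x v : Param 𝕜 M d) (α : ℝ) :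
    D.mulVec (x + α • v).ofLp = D.mulVec x.ofLp + α • D.mulVec v.ofLp := by
  rw [WithLp.ofLp_add, WithLp.ofLp_smul, Matrix.mulVec_add, Matrix.mulVec_smul]

theorem lintegral_measLaw {f : (Fin L → 𝕜) → ENNReal} (hf : Measurable f) :
    ∫⁻ y, f y ∂measLaw D σ x = ∫⁻ w, f (D.mulVec x.ofLp + w) ∂noise 𝕜 L σ :=
  lintegral_map hf (by fun_prop)

theorem memLp_error_of_mse_lt_top (hm : Measurable xhat) (hfin : mse D σ xhat x < ⊤) :
    MemLp (fun w => xhat (D.mulVec x.ofLp + w) - x) 2 (noise 𝕜 L σ) := by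
  have hmeas : Measurable fun w => xhat (D.mulVec x.ofLp + w) - x := by fun_prop
  refine ⟨hmeas.aestronglyMeasurable, ?_⟩
  rw [eLpNorm_lt_top_iff_lintegral_rpow_enorm_lt_top two_ne_zero ENNReal.ofNat_ne_top]
  rw [mse, lintegral_measLaw (by fun_prop)] at hfin
  simpa using hfin

/-- The correlation of the error of a locally unbiased estimator with the score in the direction
`D v`, for each feasible `v`. -/
theorem integral_score_smul_error (hσ : 0 < σ) (hm : Measurable xhat)
    (hfin : mse D σ xhat x < ⊤) (hu : IsConstraintUnbiased D σ k xhat x) {v : Param 𝕜 M d}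
    (hv : IsFeasibleDirection k x v) :
    ∫ w, score σ (D.mulVec v.ofLp) w • (xhat (D.mulVec x.ofLp + w) - x) ∂noise 𝕜 L σ = v := by
  refine (hasDerivAt_integral_comp_add hσ _ (memLp_error_of_mse_lt_top hm hfin)).unique ?_
  -- Adding `α • v` back to the bias leaves the mean of `xhat - x` with `x` fixed.
  have h1 : HasDerivAt (fun α : ℝ => bias D σ xhat (x + α • v) + α • v) v 0 := by
    exact ((hu.hasDerivAt_bias v hv).add ((hasDerivAt_id (0 : ℝ)).smul_const v)).congr_deriv
      (by simp)
  refine h1.congr_of_eventuallyEq ?_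
  filter_upwards [hu.integrable_near v hv] with α hα
  have hmap : Measurable fun w : Fin L → 𝕜 => D.mulVec (x + α • v).ofLp + w := by fun_prop
  have hint : Integrable (fun w => xhat (D.mulVec (x + α • v).ofLp + w)) (noise 𝕜 L σ) :=
    hα.comp_measurable hmap
  have hE : ∫ y, xhat y ∂measLaw D σ (x + α • v) =
      ∫ w, xhat (D.mulVec (x + α • v).ofLp + w) ∂noise 𝕜 L σ :=
    integral_map hmap.aemeasurable hm.aestronglyMeasurable
  rw [mulVec_add_smul] at hE hint
  simp_rw [← add_assoc]
  rw [bias, hE, integral_sub hint (integrable_const _)]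
  simp only [integral_const, probReal_univ, one_smul]
  abel

end Estimator

/-! ### The bound at maximal support. -/

/-- The vector with blocks `z` on `I` and zero elsewhere. -/
def extendBlocks (I : Finset (Fin M)) (z : I × Fin d → 𝕜) : Param 𝕜 M d :=
  WithLp.toLp 2 fun q => if h : q.1 ∈ I then z (⟨q.1, h⟩, q.2) else 0

theorem extendBlocks_apply (I : Finset (Fin M)) (z : I × Fin d → 𝕜) (p : I × Fin d) :
    extendBlocks I z (p.1.1, p.2) = z p := by
  simp [extendBlocks]

theorem supp_extendBlocks_subset (I : Finset (Fin M)) (z : I × Fin d → 𝕜) :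
    supp (extendBlocks I z) ⊆ I := by
  intro i hi
  obtain ⟨j, hj⟩ := mem_supp.1 hi
  by_contra h
  exact hj (by simp [extendBlocks, h])

theorem blockIndex_injective (I : Finset (Fin M)) :
    Function.Injective fun p : I × Fin d => ((p.1.1, p.2) : Fin M × Fin d) := by
  rintro ⟨⟨i, hi⟩, j⟩ ⟨⟨i', hi'⟩, j'⟩ h
  simp_all

theorem mulVec_extendBlocks (D : Matrix (Fin L) (Fin M × Fin d) 𝕜) (I : Finset (Fin M))
    (z : I × Fin d → 𝕜) :
    D.mulVec (extendBlocks I z).ofLp = (subDict D I).mulVec z := by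
  funext l
  refine (Fintype.sum_of_injective _ (blockIndex_injective I) _ _ (fun q hq => ?_)
    fun p => ?_).symm
  · have : q.1 ∉ I := fun h => hq ⟨(⟨q.1, h⟩, q.2), rfl⟩
    simp [extendBlocks, this]
  · rw [extendBlocks_apply]
    rfl

/-- With `G = B* B`, the matrix `B G⁻¹` is the adjoint of the pseudo-inverse of `B`, and its own
Gram matrix is `G⁻¹ G G⁻¹ = G⁻¹`. -/
theorem star_dotProduct_mulVec_inv_gram {m n : Type*} [Fintype m] [Fintype n] [DecidableEq n]
    (B : Matrix m n 𝕜) (hB : LinearIndependent 𝕜 B.col) (p : n) :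
    star (B.mulVec fun q => (B.conjTranspose * B)⁻¹ q p) ⬝ᵥ
      (B.mulVec fun q => (B.conjTranspose * B)⁻¹ q p) = (B.conjTranspose * B)⁻¹ p p := by
  open ComplexOrder in
  have hpos := Matrix.PosDef.conjTranspose_mul_self B (Matrix.mulVec_injective_iff.2 hB)
  have hdet : IsUnit (B.conjTranspose * B).det := (Matrix.isUnit_iff_isUnit_det _).1 hpos.isUnit
  set G := B.conjTranspose * B with hG
  have hGh : (G⁻¹).conjTranspose = G⁻¹ := by
    rw [Matrix.conjTranspose_nonsing_inv, hG, Matrix.conjTranspose_mul,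
      Matrix.conjTranspose_conjTranspose]
  have h1 : (B * G⁻¹).conjTranspose * (B * G⁻¹) = G⁻¹ := by
    rw [Matrix.conjTranspose_mul, hGh, Matrix.mul_assoc, ← Matrix.mul_assoc B.conjTranspose, ← hG,
      Matrix.mul_nonsing_inv _ hdet, Matrix.mul_one]
  exact congrFun (congrFun h1 p) p

theorem sum_blocks_norm_sq_le (I : Finset (Fin M)) (v : Param 𝕜 M d) :
    ∑ p : I × Fin d, ‖v (p.1.1, p.2)‖ ^ 2 ≤ ‖v‖ ^ 2 := by
  rw [EuclideanSpace.norm_sq_eq]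
  refine (Finset.sum_map Finset.univ ⟨_, blockIndex_injective I⟩ fun q => ‖v q‖ ^ 2).symm.trans_le ?_
  exact Finset.sum_le_sum_of_subset_of_nonneg (Finset.subset_univ _) fun _ _ _ => by positivity

/-- The Cramér–Rao bound at a point with maximal support. -/
theorem trace_inv_gram_le_mse {D : Matrix (Fin L) (Fin M × Fin d) 𝕜} (hD : IsDictionary D k)
    {σ : ℝ} (hσ : 0 < σ) {x : Param 𝕜 M d} (hx : (supp x).card = k)
    {xhat : (Fin L → 𝕜) → Param 𝕜 M d} (hm : Measurable xhat)
    (hu : IsConstraintUnbiased D σ k xhat x) :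
    ENNReal.ofReal (σ ^ 2 * RCLike.re
      (((subDict D (supp x)).conjTranspose * subDict D (supp x))⁻¹).trace) ≤ mse D σ xhat x := by
  obtain hinf | hfin := eq_top_or_lt_top (mse D σ xhat x)
  · exact hinf ▸ le_top
  have hT := memLp_error_of_mse_lt_top hm hfin
  set T : (Fin L → 𝕜) → Param 𝕜 M d := fun w => xhat (D.mulVec x.ofLp + w) - x with hTdef
  set B := subDict D (supp x) with hB
  set G := B.conjTranspose * B with hG
  have hmse : mse D σ xhat x = ENNReal.ofReal (∫ w, ‖T w‖ ^ 2 ∂noise 𝕜 L σ) := by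
    rw [mse, lintegral_measLaw (by fun_prop),
      ofReal_integral_eq_lintegral_ofReal hT.integrable_norm_pow'
        (ae_of_all _ fun _ => by positivity)]
    refine lintegral_congr fun w => ?_
    rw [ENNReal.ofReal_pow (norm_nonneg _), ofReal_norm]
  have hZ : ∀ q : Fin M × Fin d, MemLp (fun w => T w q) 2 (noise 𝕜 L σ) := fun q =>
    (EuclideanSpace.proj (𝕜 := 𝕜) q).comp_memLp' hT
  have hscore : ∀ (z : supp x × Fin d → 𝕜) (p : supp x × Fin d),
      ∫ w, score σ (B.mulVec z) w • T w (p.1.1, p.2) ∂noise 𝕜 L σ = z p := by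
    intro z p
    have h1 := integral_score_smul_error hσ hm hfin hu
      (isFeasibleDirection_of_supp_subset subset_rfl (supp_extendBlocks_subset (supp x) z) hx.le)
    rw [mulVec_extendBlocks] at h1
    have h2 := ((EuclideanSpace.proj (𝕜 := 𝕜) ((p.1.1, p.2) : Fin M × Fin d)).restrictScalars
      ℝ).integral_comp_comm (integrable_score_smul hσ (B.mulVec z) hT)
    rw [h1] at h2
    simpa [extendBlocks_apply] using h2
  have hcoord : ∀ p : supp x × Fin d,
      σ ^ 2 * RCLike.re (G⁻¹ p p) ≤ ∫ w, ‖T w (p.1.1, p.2)‖ ^ 2 ∂noise 𝕜 L σ := by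
    intro p
    have h0 := star_dotProduct_mulVec_inv_gram B (hD.fullColumnRank _ hx.le) p
    rw [← hG] at h0
    rw [← h0]
    refine le_integral_norm_sq_of_score hσ _ (hZ _) ?_ ?_
    · rw [hscore, h0]
    -- The feasible directions supported in `supp x` form a `𝕜`-subspace, so multiplication by `I`
    -- stays feasible.
    · rw [← Matrix.mulVec_smul, hscore, h0]
      rfl
  rw [hmse]
  refine ENNReal.ofReal_le_ofReal ?_
  calc σ ^ 2 * RCLike.re G⁻¹.trace = ∑ p, σ ^ 2 * RCLike.re (G⁻¹ p p) := by
        rw [Matrix.trace, map_sum, Finset.mul_sum]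
        rfl
    _ ≤ ∑ p : supp x × Fin d, ∫ w, ‖T w (p.1.1, p.2)‖ ^ 2 ∂noise 𝕜 L σ :=
        Finset.sum_le_sum fun p _ => hcoord p
    _ = ∫ w, ∑ p : supp x × Fin d, ‖T w (p.1.1, p.2)‖ ^ 2 ∂noise 𝕜 L σ :=
        (integral_finsetSum _ fun p _ => (hZ _).integrable_norm_pow').symm
    _ ≤ ∫ w, ‖T w‖ ^ 2 ∂noise 𝕜 L σ :=
        integral_mono (integrable_finsetSum _ fun p _ => (hZ _).integrable_norm_pow')
          hT.integrable_norm_pow' fun w => sum_blocks_norm_sq_le _ _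

/-! ### Impossibility at non-maximal support. -/

/-- The part of `v` in the block `i`. -/
def blockPart (v : Param 𝕜 M d) (i : Fin M) : Param 𝕜 M d :=
  WithLp.toLp 2 fun q => if q.1 = i then v q else 0

theorem sum_blockPart (v : Param 𝕜 M d) : ∑ i, blockPart v i = v := by
  ext q
  simp [blockPart]

theorem supp_blockPart_subset (v : Param 𝕜 M d) (i : Fin M) : supp (blockPart v i) ⊆ {i} := by
  intro l hl
  obtain ⟨j, hj⟩ := mem_supp.1 hl
  by_contra h
  exact hj (by simp [blockPart, Finset.mem_singleton.not.1 h])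

theorem score_sum {ι : Type*} (s : Finset ι) (σ : ℝ) (u : ι → Fin L → 𝕜) (w : Fin L → 𝕜) :
    score σ (∑ i ∈ s, u i) w = ∑ i ∈ s, score σ (u i) w := by
  simp only [score, star_sum, sum_dotProduct, map_sum, Finset.sum_div]

theorem exists_ne_zero_mulVec_eq_zero {D : Matrix (Fin L) (Fin M × Fin d) 𝕜}
    (h : L < M * d) : ∃ v : Param 𝕜 M d, v ≠ 0 ∧ D.mulVec v.ofLp = 0 := by
  have hlt : Module.finrank 𝕜 (Fin L → 𝕜) < Module.finrank 𝕜 (Fin M × Fin d → 𝕜) := by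
    simpa using h
  obtain ⟨v, hv, hv0⟩ := Submodule.exists_mem_ne_zero_of_ne_bot
    (LinearMap.ker_ne_bot_of_finrank_lt (f := D.mulVecLin) hlt)
  exact ⟨WithLp.toLp 2 v, by simpa using hv0, hv⟩

/-- No estimator of finite variance is locally unbiased at a point with non-maximal support. -/
theorem not_isConstraintUnbiased {D : Matrix (Fin L) (Fin M × Fin d) 𝕜}
    (hD : IsDictionary D k) {σ : ℝ} (hσ : 0 < σ) {x : Param 𝕜 M d} (hx : (supp x).card < k)
    {xhat : (Fin L → 𝕜) → Param 𝕜 M d} (hm : Measurable xhat)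
    (hvar : HasFiniteVariance D σ xhat x) : ¬ IsConstraintUnbiased D σ k xhat x := by
  intro hu
  have hmean : ∫ z, xhat z ∂measLaw D σ x = x := sub_eq_zero.1 hu.bias_eq_zero
  have hfin : mse D σ xhat x < ⊤ := by
    rw [HasFiniteVariance, hmean] at hvar
    exact hvar
  -- This `v` need not be feasible itself; only its block parts have to be.
  obtain ⟨v, hv0, hv⟩ := exists_ne_zero_mulVec_eq_zero (D := D) hD.underdetermined
  refine hv0 ?_
  have hT := memLp_error_of_mse_lt_top hm hfin
  have hsum : ∑ i, D.mulVec (blockPart v i).ofLp = 0 := by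
    rw [← Matrix.mulVec_sum, ← WithLp.ofLp_sum, sum_blockPart, hv]
  -- One spare block suffices: `supp x` together with `i` has at most `k` elements.
  have hfeas : ∀ i, IsFeasibleDirection k x (blockPart v i) := fun i =>
    isFeasibleDirection_of_supp_subset (Finset.subset_insert i _)
      ((supp_blockPart_subset v i).trans (by simp)) ((Finset.card_insert_le _ _).trans hx)
  calc v = ∑ i, blockPart v i := (sum_blockPart v).symm
    _ = ∑ i, ∫ w, score σ (D.mulVec (blockPart v i).ofLp) w •
          (xhat (D.mulVec x.ofLp + w) - x) ∂noise 𝕜 L σ :=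
        Finset.sum_congr rfl fun i _ => (integral_score_smul_error hσ hm hfin hu (hfeas i)).symm
    _ = ∫ w, score σ (∑ i, D.mulVec (blockPart v i).ofLp) w •
          (xhat (D.mulVec x.ofLp + w) - x) ∂noise 𝕜 L σ := by
        rw [← integral_finsetSum _ fun i _ => integrable_score_smul hσ _ hT]
        simp_rw [score_sum, Finset.sum_smul]
    _ = 0 := by simp [hsum, score]

end

end BlockSparse

open BlockSparse in
theorem theorem2 {𝕜 : Type*} [RCLike 𝕜] {L M d : ℕ} (k : ℕ)
    (D : Matrix (Fin L) (Fin M × Fin d) 𝕜) (hD : IsDictionary D k)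
    (σ : ℝ) (hσ : 0 < σ) (x : Param 𝕜 M d) :
    ((supp x).card < k →
      ¬ ∃ xhat : (Fin L → 𝕜) → Param 𝕜 M d,
        Measurable xhat ∧ HasFiniteVariance D σ xhat x ∧ IsConstraintUnbiased D σ k xhat x) ∧
    ((supp x).card = k →
      ∀ xhat : (Fin L → 𝕜) → Param 𝕜 M d,
        Measurable xhat → IsConstraintUnbiased D σ k xhat x →
          ENNReal.ofReal (σ ^ 2 * RCLike.re
            (((subDict D (supp x)).conjTranspose * subDict D (supp x))⁻¹).trace)
            ≤ mse D σ xhat x) := by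
  refine ⟨fun hx => ?_, fun hx xhat hm hu => trace_inv_gram_le_mse hD hσ hx hm hu⟩
  rintro ⟨xhat, hm, hvar, hu⟩
  exact not_isConstraintUnbiased hD hσ hx hm hvar hu
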